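/- Let $N\ge 0$ and $m\ge 1$ be integers, and let $(A_1,B_1),\dots,(A_m,B_m)$ be pairs of nonzero linear subspaces of $\mathbb{R}^N$. Write $a_i=\dim A_i$ for $1\le i\le m$, and let $b=\max_{1\le i\le m}\dim B_i$. Suppose that (i) $\dim(A_i\cap B_i)=0$ for $1\le i\le m$, and (ii) $\dim(A_i\cap B_j)>0$ for all $1\le i,j\le m$ with $i\ne j$. Then $$\sum_{i=1}^m \frac{1}{\binom{a_i+b}{a_i}}\le 1.$$ -/

import Mathlib

open Module

/-! Pad each `B i` to a space of dimension exactly `b` inside `V = ℝ^N × ℝ^b`; the wedge of a basis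
of it is a decomposable alternating `b`-form on `Dual V`. This form vanishes on the annihilator of
`A j` (of codimension `a j`) precisely when the padded space meets `A j`, so for `j ≠ i` but not for
`j = i`.

`skew_bollobas_alternating` inducts on `n = dim E`, carrying a space `T` of forms that vanish on
every `C j`. Once `n ≤ a j + b`, the form of `j` is absorbed into `T`: its dimension grows by one,
worth `1 / n.choose b`, at least the term of `j`. For the remaining `j`, `C j` contains a nonzero `z
j` killed by the form, so restriction to a hyperplane missing all `z j` keeps the hypotheses.
Averaging over the coordinate hyperplanes of a generic basis (`exists_coordinate_restriction`) gives
one where `dim T / n.choose b` does not decrease. In the end only `dim T ≤ n.choose b` is needed. -/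

/-- An alternating map vanishing on all increasing tuples of basis vectors is zero. -/
theorem AlternatingMap.eq_zero_of_orderEmbOfFin {K E : Type*} [Field K] [AddCommGroup E]
    [Module K E] {n b : ℕ} (x : Basis (Fin n) K E) (f : E [⋀^Fin b]→ₗ[K] K)
    (h : ∀ s : {s : Finset (Fin n) // s.card = b}, f (fun k => x (s.1.orderEmbOfFin s.2 k)) = 0) :
    f = 0 := by
  refine x.ext_alternating fun v hv => ?_
  have hs : (Finset.univ.image v).card = b := by
    rw [Finset.card_image_of_injective _ hv]; simp
  let e₁ := (Finset.univ.image v).orderIsoOfFin hs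
  have hb : Function.Bijective
      (fun k => (⟨v k, by simp⟩ : {t // t ∈ Finset.univ.image v})) := by
    refine ⟨fun i j hij => hv (by simpa using hij), ?_⟩
    rintro ⟨t, ht⟩
    obtain ⟨k, -, rfl⟩ := Finset.mem_image.1 ht
    exact ⟨k, rfl⟩
  let σ : Equiv.Perm (Fin b) := (Equiv.ofBijective _ hb).trans e₁.symm.toEquiv
  have hσ : ∀ k, (Finset.univ.image v).orderEmbOfFin hs (σ k) = v k := by
    intro k
    rw [← Finset.coe_orderIsoOfFin_apply]
    simp [σ, e₁]
  have := f.map_perm (fun k => x ((Finset.univ.image v).orderEmbOfFin hs k)) σ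
  rw [h ⟨_, hs⟩, smul_zero] at this
  simpa [Function.comp_def, hσ] using this

/-- Evaluation at a tuple, as a linear functional on alternating maps. -/
def AlternatingMap.evalₗ {K E : Type*} [Field K] [AddCommGroup E] [Module K E] {b : ℕ}
    (w : Fin b → E) : (E [⋀^Fin b]→ₗ[K] K) →ₗ[K] K where
  toFun f := f w
  map_add' _ _ := rfl
  map_smul' _ _ := rfl

@[simp] theorem AlternatingMap.evalₗ_apply {K E : Type*} [Field K] [AddCommGroup E] [Module K E]
    {b : ℕ} (w : Fin b → E) (f : E [⋀^Fin b]→ₗ[K] K) : AlternatingMap.evalₗ w f = f w := rfl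

/-- Restriction of alternating maps to a submodule. -/
def AlternatingMap.restrictₗ {K E : Type*} [Field K] [AddCommGroup E] [Module K E] (b : ℕ)
    (H : Submodule K E) : (E [⋀^Fin b]→ₗ[K] K) →ₗ[K] (H [⋀^Fin b]→ₗ[K] K) where
  toFun f := f.compLinearMap H.subtype
  map_add' _ _ := rfl
  map_smul' _ _ := rfl

@[simp] theorem AlternatingMap.restrictₗ_apply {K E : Type*} [Field K] [AddCommGroup E]
    [Module K E] {b : ℕ} (H : Submodule K E) (f : E [⋀^Fin b]→ₗ[K] K) (w : Fin b → H) :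
    AlternatingMap.restrictₗ b H f w = f (fun k => (w k : E)) := rfl

theorem AlternatingMap.finiteDimensional {K E : Type*} [Field K] [AddCommGroup E] [Module K E]
    [FiniteDimensional K E] (b : ℕ) : FiniteDimensional K (E [⋀^Fin b]→ₗ[K] K) := by
  let x := finBasis K E
  let Φ : (E [⋀^Fin b]→ₗ[K] K) →ₗ[K]
      ({s : Finset (Fin (finrank K E)) // s.card = b} → K) :=
    LinearMap.pi fun s => AlternatingMap.evalₗ fun k => x (s.1.orderEmbOfFin s.2 k)
  refine FiniteDimensional.of_injective Φ ?_
  rw [injective_iff_map_eq_zero]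
  intro f hf
  exact AlternatingMap.eq_zero_of_orderEmbOfFin x f fun s => congrFun hf s

/-- A separating family of functionals contains a basis of the dual space. -/
theorem exists_finset_linearIndependent_of_separating {K M X : Type*} [Field K] [AddCommGroup M]
    [Module K M] [FiniteDimensional K M] [Finite X] (ev : X → Dual K M)
    (h : ∀ z, (∀ s, ev s z = 0) → z = 0) :
    ∃ S : Finset X, S.card = finrank K M ∧ LinearIndependent K (fun s : S => ev s) := by
  classical
  have hspan : Submodule.span K (Set.range ev) = ⊤ := by
    refine Submodule.span_eq_top_of_ne_zero fun z hz => ?_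
    by_contra! h'
    exact hz (h z fun s => h' (ev s) ⟨s, rfl⟩)
  obtain ⟨κ, a, ha, hsp, hli⟩ := exists_linearIndependent' K ev
  have : Finite κ := Finite.of_injective a ha
  have := Fintype.ofFinite κ
  have hcard : Fintype.card κ = finrank K M := by
    rw [← Subspace.dual_finrank_eq, ← finrank_top K (Dual K M), ← hspan, ← hsp,
      finrank_span_eq_card hli]
  refine ⟨Finset.univ.image a, ?_, ?_⟩
  · rw [Finset.card_image_of_injective _ ha, Finset.card_univ, hcard]
  · have h2 : LinearIndepOn K ev (Set.range a) :=
      (linearIndependent_equiv (Equiv.ofInjective a ha) (f := fun s => ev s.1)).1 hli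
    have h3 : (↑(Finset.univ.image a) : Set X) = Set.range a := by simp
    rw [← h3] at h2
    exact h2

/-- A subspace of alternating maps is coordinatised by some `b`-subsets of any basis. -/
theorem exists_coordinate_subsets {K E : Type*} [Field K] [AddCommGroup E] [Module K E]
    [FiniteDimensional K E] {n b : ℕ} (x : Basis (Fin n) K E)
    (T : Submodule K (E [⋀^Fin b]→ₗ[K] K)) :
    ∃ S : Finset {s : Finset (Fin n) // s.card = b}, S.card = finrank K T ∧
      LinearIndependent K (fun s : S =>
        (AlternatingMap.evalₗ fun k => x (s.1.1.orderEmbOfFin s.1.2 k)).domRestrict T) := by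
  have := AlternatingMap.finiteDimensional (K := K) (E := E) b
  have : FiniteDimensional K T := FiniteDimensional.finiteDimensional_submodule T
  let ev : {s : Finset (Fin n) // s.card = b} → Dual K T := fun s =>
    (AlternatingMap.evalₗ fun k => x (s.1.orderEmbOfFin s.2 k)).domRestrict T
  obtain ⟨S, hS, hli⟩ := exists_finset_linearIndependent_of_separating (M := T) ev
    fun z hz => by
      have h : z.1 = 0 := AlternatingMap.eq_zero_of_orderEmbOfFin x z.1 hz
      exact Subtype.ext h
  exact ⟨S, hS, hli⟩

/-! ### Dimension counts and averaging over coordinate hyperplanes -/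

theorem finrank_alternating_submodule_le {K E : Type*} [Field K] [AddCommGroup E] [Module K E]
    [FiniteDimensional K E] {b : ℕ} (T : Submodule K (E [⋀^Fin b]→ₗ[K] K)) :
    finrank K T ≤ (finrank K E).choose b := by
  obtain ⟨S, hS, -⟩ := exists_coordinate_subsets (finBasis K E) T
  rw [← hS]
  refine (Finset.card_le_univ S).trans ?_
  simp [Fintype.card_finset_len]

/-- If `s` avoids `i`, its basis tuple lies in `H`, so evaluation there factors through restriction
to `H`; independence upstairs forces independence downstairs. -/
theorem card_avoiding_le_finrank_map {K E : Type*} [Field K] [AddCommGroup E] [Module K E]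
    [FiniteDimensional K E] {n b : ℕ} (x : Basis (Fin n) K E)
    (T : Submodule K (E [⋀^Fin b]→ₗ[K] K)) (S : Finset {s : Finset (Fin n) // s.card = b})
    (hS : LinearIndependent K (fun s : S =>
        (AlternatingMap.evalₗ fun k => x (s.1.1.orderEmbOfFin s.1.2 k)).domRestrict T))
    (H : Submodule K E) (i : Fin n) (hH : ∀ k ≠ i, x k ∈ H) :
    (S.filter fun s => i ∉ s.1).card ≤ finrank K (T.map (AlternatingMap.restrictₗ b H)) := by
  classical
  have := AlternatingMap.finiteDimensional (K := K) (E := H) b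
  let T' := T.map (AlternatingMap.restrictₗ b H)
  let r : T →ₗ[K] T' := (AlternatingMap.restrictₗ b H).submoduleMap T
  have hmem : ∀ s : (S.filter fun s => i ∉ s.1), ∀ k, x (s.1.1.orderEmbOfFin s.1.2 k) ∈ H := by
    intro s k
    refine hH _ fun h => (Finset.mem_filter.1 s.2).2 ?_
    have := Finset.orderEmbOfFin_mem s.1.1 s.1.2 k
    rwa [h] at this
  let ev' : (S.filter fun s => i ∉ s.1) → Dual K T' := fun s =>
    (AlternatingMap.evalₗ fun k => (⟨x (s.1.1.orderEmbOfFin s.1.2 k), hmem s k⟩ : H)).domRestrict T'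
  have hli : LinearIndependent K ev' := by
    refine LinearIndependent.of_comp r.dualMap ?_
    have := hS.comp (fun s : (S.filter fun s => i ∉ s.1) =>
      (⟨s.1, (Finset.mem_filter.1 s.2).1⟩ : S)) (fun s t h => by
        ext1; simpa using congrArg Subtype.val h)
    exact this
  have := hli.fintype_card_le_finrank
  have hd : finrank K (Dual K T') = finrank K T' :=
    Subspace.dual_finrank_eq (K := K) (V := T')
  rw [hd, Fintype.card_coe] at this
  exact this

/-- Some coordinate hyperplane keeps at least the average share of the dimension. -/
theorem exists_coordinate_restriction {K E : Type*} [Field K] [AddCommGroup E] [Module K E]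
    [FiniteDimensional K E] {n b : ℕ} (hn : 0 < n) (x : Basis (Fin n) K E)
    (T : Submodule K (E [⋀^Fin b]→ₗ[K] K)) :
    ∃ i, (n - b) * finrank K T ≤
      n * finrank K (T.map (AlternatingMap.restrictₗ b (LinearMap.ker (x.coord i)))) := by
  classical
  obtain ⟨S, hS, hli⟩ := exists_coordinate_subsets x T
  -- Double counting: each `b`-set avoids `n - b` indices.
  have hsum : ∑ i, (S.filter fun s => i ∉ s.1).card = (n - b) * S.card := by
    simp_rw [Finset.card_filter]
    rw [Finset.sum_comm]
    have : ∀ s ∈ S, (∑ i : Fin n, if i ∉ s.1 then 1 else 0) = n - b := by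
      intro s _
      rw [← Finset.card_filter, Finset.filter_not, Finset.card_sdiff_of_subset (by simp)]
      simp [s.2]
    rw [Finset.sum_congr rfl this]
    simp [mul_comm]
  by_contra! h
  have h2 : ∑ i : Fin n, n * (S.filter fun s => i ∉ s.1).card <
      ∑ i : Fin n, (n - b) * finrank K T := by
    refine Finset.sum_lt_sum_of_nonempty ⟨⟨0, hn⟩, by simp⟩ fun i _ => ?_
    refine lt_of_le_of_lt (Nat.mul_le_mul_left _ ?_) (h i)
    refine card_avoiding_le_finrank_map x T S hli _ i fun k hk => ?_
    simp [hk]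
  rw [← Finset.mul_sum, hsum, hS] at h2
  simp at h2

/-! ### Generic bases and independence modulo `T` -/

/-- Over an infinite field the covectors nonzero at every `z j` span the dual; a basis extracted
from them is the coordinate system of a basis of `E`. -/
theorem exists_basis_coord_ne_zero {K E ι : Type*} [Field K] [Infinite K] [AddCommGroup E]
    [Module K E] [FiniteDimensional K E] [Finite ι] {n : ℕ} (hn : finrank K E = n)
    (z : ι → E) (hz : ∀ j, z j ≠ 0) :
    ∃ x : Basis (Fin n) K E, ∀ i j, x.coord i (z j) ≠ 0 := by
  let s : Set (Dual K E) := {e | ∀ j, e (z j) ≠ 0}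
  have hs : Submodule.span K s = ⊤ := by
    refine Submodule.span_eq_top_of_ne_zero fun w hw => ?_
    -- `Option ι` adjoins `w` to the vectors to be avoided.
    obtain ⟨f, hf⟩ := exists_dual_forall_apply_ne_zero (K := K)
      (fun o : Option ι => o.elim w z) (by rintro (_ | j) <;> simp [hw, hz])
    exact ⟨f, fun j => hf (some j), hf none⟩
  obtain ⟨t, hts, hsp, hli⟩ := exists_linearIndependent K s
  let y₀ : Basis t K (Dual K E) := Basis.mk hli (by
    rw [Subtype.range_coe_subtype, Set.ofPred_mem_eq, hsp, hs])
  have : Finite t := Module.Finite.finite_basis y₀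
  have := Fintype.ofFinite t
  have hc : Fintype.card t = n := by
    rw [← hn, ← Subspace.dual_finrank_eq, finrank_eq_card_basis y₀]
  let y : Basis (Fin n) K (Dual K E) := y₀.reindex (Fintype.equivFinOfCardEq hc)
  have hy : ∀ i, y i ∈ s := by
    intro i
    simp only [y, y₀, Basis.reindex_apply, Basis.mk_apply]
    exact hts (Subtype.coe_prop _)
  refine ⟨y.dualBasis.map (evalEquiv K E).symm, fun i j => ?_⟩
  suffices (y.dualBasis.map (evalEquiv K E).symm).coord i = y i by
    rw [this]; exact hy i j
  refine (y.dualBasis.map (evalEquiv K E).symm).ext fun k => ?_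
  rw [Basis.coord_apply, Basis.repr_self, Basis.map_apply, apply_evalEquiv_symm_apply,
    Basis.coe_dualBasis, Basis.coord_apply, Basis.repr_self]
  simp [Finsupp.single_apply, eq_comm]

/-- `L j` kills `T` and every other `β i` but not `β j`, so each added `β j` strictly enlarges the
span. -/
theorem finrank_add_card_le_finrank_sup_span {K M ι : Type*} [Field K] [AddCommGroup M]
    [Module K M] [FiniteDimensional K M] [DecidableEq ι] (T : Submodule K M) (β : ι → M)
    (L : ι → Dual K M) (G : Finset ι) (hT : ∀ j ∈ G, ∀ τ ∈ T, L j τ = 0)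
    (hβ : ∀ i ∈ G, ∀ j ∈ G, i ≠ j → L j (β i) = 0) (hL : ∀ j ∈ G, L j (β j) ≠ 0) :
    finrank K T + G.card ≤ finrank K (T ⊔ Submodule.span K (β '' G) : Submodule K M) := by
  induction G using Finset.induction_on with
  | empty =>
    simpa using Submodule.finrank_mono
      (le_sup_left : T ≤ T ⊔ Submodule.span K (β '' (∅ : Finset ι)))
  | insert j G hj ih =>
    have ih' := ih (fun i hi => hT i (Finset.mem_insert_of_mem hi))
      (fun i hi k hk => hβ i (Finset.mem_insert_of_mem hi) k (Finset.mem_insert_of_mem hk))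
      (fun i hi => hL i (Finset.mem_insert_of_mem hi))
    have hlt : T ⊔ Submodule.span K (β '' G) <
        T ⊔ Submodule.span K (β '' (insert j G : Finset ι)) := by
      refine lt_of_le_of_ne (sup_le_sup_left (Submodule.span_mono (Set.image_mono ?_)) _) ?_
      · exact_mod_cast Finset.subset_insert j G
      · intro heq
        have h1 : β j ∈ T ⊔ Submodule.span K (β '' G) := by
          rw [heq]
          exact Submodule.mem_sup_right (Submodule.subset_span ⟨j, by simp, rfl⟩)
        have h2 : T ⊔ Submodule.span K (β '' G) ≤ LinearMap.ker (L j) := by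
          refine sup_le (fun τ hτ => hT j (by simp) τ hτ) (Submodule.span_le.2 ?_)
          rintro _ ⟨i, hi, rfl⟩
          exact hβ i (Finset.mem_insert_of_mem hi) j (by simp) (fun h => hj (h ▸ hi))
        exact hL j (by simp) (h2 h1)
    have := Submodule.finrank_lt_finrank_of_lt hlt
    rw [Finset.card_insert_of_notMem hj]
    omega

/-! ### Decomposable forms and restriction to a hyperplane -/

/-- The decomposable alternating form `w ↦ det (u k (w l))`. -/
noncomputable def detForm {K E : Type*} [Field K] [AddCommGroup E] [Module K E] {b : ℕ}
    (u : Fin b → Dual K E) : E [⋀^Fin b]→ₗ[K] K :=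
  Matrix.detRowAlternating.compLinearMap (LinearMap.pi u)

theorem detForm_apply {K E : Type*} [Field K] [AddCommGroup E] [Module K E] {b : ℕ}
    (u : Fin b → Dual K E) (w : Fin b → E) :
    detForm u w = (Matrix.of fun l k => u k (w l)).det := rfl

theorem detForm_eq_zero_of_not_linearIndependent {K E : Type*} [Field K] [AddCommGroup E]
    [Module K E] {b : ℕ} {u : Fin b → Dual K E} {C : Submodule K E}
    (h : ¬ LinearIndependent K fun k => (u k).domRestrict C) {w : Fin b → E}
    (hw : ∀ k, w k ∈ C) : detForm u w = 0 := by
  rw [Fintype.not_linearIndependent_iff] at h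
  obtain ⟨c, hc, i, hi⟩ := h
  rw [detForm_apply, ← Matrix.exists_mulVec_eq_zero_iff]
  refine ⟨c, fun h0 => hi (congrFun h0 i), funext fun l => ?_⟩
  have := LinearMap.congr_fun hc ⟨w l, hw l⟩
  simpa [Matrix.mulVec, dotProduct, mul_comm] using this

theorem exists_detForm_ne_zero {K E : Type*} [Field K] [AddCommGroup E] [Module K E] {b : ℕ}
    {u : Fin b → Dual K E} {C : Submodule K E}
    (h : LinearIndependent K fun k => (u k).domRestrict C) :
    ∃ w : Fin b → E, (∀ k, w k ∈ C) ∧ detForm u w ≠ 0 := by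
  let f : Fin b → C → K := fun k x => u k x
  have hf : LinearIndependent K f := by
    rw [Fintype.linearIndependent_iff] at h ⊢
    intro g hg
    refine h g (LinearMap.ext fun x => ?_)
    simpa [f] using congrFun hg x
  have hsurj : Function.Surjective (LinearMap.pi fun k => (u k).domRestrict C) := by
    rw [← LinearMap.range_eq_top, ← span_flip_eq_top_iff_linearIndependent.2 hf]
    exact (Submodule.span_eq (LinearMap.range (LinearMap.pi fun k => (u k).domRestrict C))).symm
  choose w hw using fun k : Fin b => hsurj (Pi.single k 1)
  refine ⟨fun k => w k, fun k => (w k).2, ?_⟩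
  have : (Matrix.of fun l k => u k (w l : E)) = (1 : Matrix (Fin b) (Fin b) K) := by
    ext l k
    have := congrFun (hw l) k
    simpa [Matrix.one_apply, Pi.single_apply, eq_comm] using this
  rw [detForm_apply, this]
  simp

/-- `C` is spanned by `C ∩ ker e` and `z`; as every `u k` kills `z`, a relation on the hyperplane
already holds on `C`. -/
theorem linearIndependent_domRestrict_ker {K E : Type*} [Field K] [AddCommGroup E] [Module K E]
    {b : ℕ} {u : Fin b → Dual K E} {C : Submodule K E} {e : Dual K E} {z : E} (hz : z ∈ C)
    (hez : e z ≠ 0) (huz : ∀ k, u k z = 0)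
    (h : LinearIndependent K fun k => (u k).domRestrict C) :
    LinearIndependent K fun k => ((u k).domRestrict (LinearMap.ker e)).domRestrict
      (C.comap (LinearMap.ker e).subtype) := by
  rw [Fintype.linearIndependent_iff] at h ⊢
  intro g hg
  refine h g (LinearMap.ext fun x => ?_)
  have hy : (x : E) - (e x / e z) • z ∈ LinearMap.ker e := by
    simp [div_mul_cancel₀ _ hez]
  have := LinearMap.congr_fun hg
    ⟨⟨(x : E) - (e x / e z) • z, hy⟩, C.sub_mem x.2 (C.smul_mem _ hz)⟩
  simpa [huz] using this

theorem LinearIndependent.of_domRestrict_comap {K E : Type*} [Field K] [AddCommGroup E]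
    [Module K E] {b : ℕ} {u : Fin b → Dual K E} {C H : Submodule K E}
    (h : LinearIndependent K fun k => ((u k).domRestrict H).domRestrict (C.comap H.subtype)) :
    LinearIndependent K fun k => (u k).domRestrict C := by
  rw [Fintype.linearIndependent_iff] at h ⊢
  intro g hg
  refine h g (LinearMap.ext fun x => ?_)
  simpa using LinearMap.congr_fun hg ⟨x.1.1, x.2⟩

theorem finrank_le_finrank_comap_ker_add_one {K E : Type*} [Field K] [AddCommGroup E] [Module K E]
    [FiniteDimensional K E] (C : Submodule K E) {e : Dual K E} (he : e ≠ 0) :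
    finrank K C ≤ finrank K (C.comap (LinearMap.ker e).subtype) + 1 := by
  have h1 := Submodule.finrank_sup_add_finrank_inf_eq (LinearMap.ker e) C
  have h2 := Dual.finrank_ker_add_one_of_ne_zero he
  have h3 := Submodule.finrank_le (LinearMap.ker e ⊔ C)
  rw [← Submodule.map_comap_subtype, Submodule.finrank_map_subtype_eq] at h1
  omega

theorem exists_mem_forall_dual_eq_zero {K E : Type*} [Field K] [AddCommGroup E] [Module K E]
    [FiniteDimensional K E] {b : ℕ} (u : Fin b → Dual K E) (C : Submodule K E)
    (h : b < finrank K C) : ∃ z ∈ C, z ≠ 0 ∧ ∀ k, u k z = 0 := by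
  have := LinearMap.ker_ne_bot_of_finrank_lt
    (f := LinearMap.pi fun k => (u k).domRestrict C) (by simpa using h)
  obtain ⟨z, hz, hz0⟩ := Submodule.exists_mem_ne_zero_of_ne_bot this
  exact ⟨z, z.2, by simpa using hz0, fun k => congrFun hz k⟩

/-! ### The induction on dimension -/

theorem div_choose_le_div_choose {m b s t : ℕ} (hb : b ≤ m)
    (h : (m + 1 - b) * s ≤ (m + 1) * t) :
    (s : ℝ) / ((m + 1).choose b : ℝ) ≤ t / (m.choose b : ℝ) := by
  have h1 : 0 < m.choose b := Nat.choose_pos hb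
  have h2 : 0 < (m + 1).choose b := Nat.choose_pos (by omega)
  rw [div_le_div_iff₀ (by exact_mod_cast h2) (by exact_mod_cast h1)]
  have h3 := Nat.choose_mul_succ_eq m b
  have : s * m.choose b ≤ t * (m + 1).choose b := by
    refine Nat.le_of_mul_le_mul_right (c := m + 1) ?_ (by omega)
    calc s * m.choose b * (m + 1) = ((m + 1 - b) * s) * (m + 1).choose b := by
          rw [mul_assoc, h3]; ring
      _ ≤ ((m + 1) * t) * (m + 1).choose b := Nat.mul_le_mul_right _ h
      _ = _ := by ring
  exact_mod_cast this

/-- A Bollobás-type inequality for decomposable alternating forms `detForm (u j)` and subspaces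
`C j` of codimension at most `a j`, in the presence of a space `T` of alternating forms vanishing
on every `C j`. The induction on the dimension restricts to a generic hyperplane. -/
theorem skew_bollobas_alternating {K ι : Type*} [Field K] [Infinite K] (a : ι → ℕ) (b n : ℕ) :
    ∀ (E : Type*) [AddCommGroup E] [Module K E] [FiniteDimensional K E], finrank K E = n →
    ∀ (J : Finset ι) (C : ι → Submodule K E) (u : ι → Fin b → Dual K E)
      (T : Submodule K (E [⋀^Fin b]→ₗ[K] K)),
      (∀ j ∈ J, n ≤ finrank K (C j) + a j) →
      (∀ j ∈ J, LinearIndependent K fun k => (u j k).domRestrict (C j)) →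
      (∀ i ∈ J, ∀ j ∈ J, i ≠ j → ¬ LinearIndependent K fun k => (u i k).domRestrict (C j)) →
      (∀ τ ∈ T, ∀ j ∈ J, ∀ w : Fin b → E, (∀ k, w k ∈ C j) → τ w = 0) →
      (finrank K T : ℝ) / n.choose b + ∑ j ∈ J, (1 : ℝ) / (a j + b).choose b ≤ 1 := by
  classical
  induction n using Nat.strong_induction_on with
  | _ n ih =>
  intro E _ _ _ hE J C u T hC hli hdep hT
  have := AlternatingMap.finiteDimensional (K := K) (E := E) b
  let G := J.filter fun j => n ≤ a j + b
  let J' := J.filter fun j => ¬ n ≤ a j + b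
  have hGJ : ∀ {j}, j ∈ G → j ∈ J := fun h => (Finset.mem_filter.1 h).1
  have hJJ : ∀ {j}, j ∈ J' → j ∈ J := fun h => (Finset.mem_filter.1 h).1
  let T' := T ⊔ Submodule.span K ((fun j => detForm (u j)) '' (G : Set ι))
  have hcard : finrank K T + G.card ≤ finrank K T' := by
    have hw : ∀ j, ∃ w : Fin b → E, j ∈ J → (∀ k, w k ∈ C j) ∧ detForm (u j) w ≠ 0 := by
      intro j
      by_cases hj : j ∈ J
      · obtain ⟨w, hw⟩ := exists_detForm_ne_zero (hli j hj)
        exact ⟨w, fun _ => hw⟩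
      · exact ⟨0, fun h => absurd h hj⟩
    choose w hw using hw
    refine finrank_add_card_le_finrank_sup_span T (fun j => detForm (u j))
      (fun j => AlternatingMap.evalₗ (w j)) G ?_ ?_ ?_
    · exact fun j hj τ hτ => hT τ hτ j (hGJ hj) _ (hw j (hGJ hj)).1
    · exact fun i hi j hj hij => detForm_eq_zero_of_not_linearIndependent
        (hdep i (hGJ hi) j (hGJ hj) hij) (hw j (hGJ hj)).1
    · exact fun j hj => (hw j (hGJ hj)).2
  have hle : finrank K T' ≤ n.choose b := hE ▸ finrank_alternating_submodule_le T'
  have hsplit : (finrank K T : ℝ) / n.choose b + ∑ j ∈ J, (1 : ℝ) / (a j + b).choose b ≤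
      (finrank K T' : ℝ) / n.choose b + ∑ j ∈ J', (1 : ℝ) / (a j + b).choose b := by
    rw [← Finset.sum_filter_add_sum_filter_not J fun j => n ≤ a j + b, ← add_assoc]
    refine add_le_add_left ?_ _
    -- If `n < b` there are no nonzero `b`-forms, so `G` is empty and both quotients are `0` by
    -- convention.
    rcases Nat.eq_zero_or_pos (n.choose b) with h0 | hpos
    · have : G = ∅ := Finset.card_eq_zero.1 (by omega)
      change _ + ∑ j ∈ G, _ ≤ _
      simp [this, h0]
    · have hG : ∑ j ∈ G, (1 : ℝ) / (a j + b).choose b ≤ G.card * (1 / n.choose b) := by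
        rw [← nsmul_eq_mul]
        refine Finset.sum_le_card_nsmul _ _ _ fun j hj => ?_
        refine one_div_le_one_div_of_le (by exact_mod_cast hpos) ?_
        exact_mod_cast Nat.choose_le_choose b (Finset.mem_filter.1 hj).2
      calc _ ≤ (finrank K T : ℝ) / n.choose b + G.card * (1 / n.choose b) :=
            add_le_add_right hG _
        _ = ((finrank K T + G.card : ℕ) : ℝ) / n.choose b := by push_cast; ring
        _ ≤ _ := by gcongr
  refine hsplit.trans ?_
  have hT' : ∀ τ ∈ T', ∀ j ∈ J', ∀ w : Fin b → E, (∀ k, w k ∈ C j) → τ w = 0 := by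
    intro τ hτ j hj w hw
    have : T' ≤ LinearMap.ker (AlternatingMap.evalₗ w) := by
      refine sup_le (fun σ hσ => hT σ hσ j (hJJ hj) w hw) (Submodule.span_le.2 ?_)
      rintro _ ⟨i, hi, rfl⟩
      refine detForm_eq_zero_of_not_linearIndependent (hdep i (hGJ hi) j (hJJ hj) ?_) hw
      rintro rfl
      exact (Finset.mem_filter.1 hj).2 (Finset.mem_filter.1 hi).2
    exact this hτ
  rcases J'.eq_empty_or_nonempty with hJ' | ⟨j₀, hj₀⟩
  · rw [hJ', Finset.sum_empty, add_zero]
    exact div_le_one_of_le₀ (by exact_mod_cast hle) (by positivity)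
  have hn₀ := (Finset.mem_filter.1 hj₀).2
  obtain ⟨m, rfl⟩ : ∃ m, n = m + 1 := ⟨n - 1, by omega⟩
  -- Here `dim C j ≥ n - a j > b`, so `b` functionals have a common zero.
  have hz : ∀ j : J', ∃ z ∈ C j, z ≠ 0 ∧ ∀ k, u j k z = 0 := by
    intro j
    refine exists_mem_forall_dual_eq_zero (u j) (C j) ?_
    have h1 := hC j (hJJ j.2)
    have h2 := (Finset.mem_filter.1 j.2).2
    omega
  choose z hzC hz0 huz using hz
  obtain ⟨x, hx⟩ := exists_basis_coord_ne_zero (K := K) hE z hz0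
  obtain ⟨i, hi⟩ := exists_coordinate_restriction (by omega) x T'
  have he : x.coord i ≠ 0 := fun h => hx i ⟨j₀, hj₀⟩ (by rw [h]; rfl)
  have hker : finrank K (LinearMap.ker (x.coord i)) = m := by
    have := Dual.finrank_ker_add_one_of_ne_zero he
    omega
  refine le_trans (add_le_add_left (div_choose_le_div_choose (b := b) (by omega) hi) _) ?_
  refine ih m (by omega) (LinearMap.ker (x.coord i)) hker J'
    (fun j => (C j).comap (LinearMap.ker (x.coord i)).subtype)
    (fun j k => (u j k).domRestrict (LinearMap.ker (x.coord i))) _ ?_ ?_ ?_ ?_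
  · intro j hj
    have h1 := hC j (hJJ hj)
    have h2 := finrank_le_finrank_comap_ker_add_one (C j) he
    omega
  · intro j hj
    exact linearIndependent_domRestrict_ker (hzC ⟨j, hj⟩) (hx i ⟨j, hj⟩) (huz ⟨j, hj⟩)
      (hli j (hJJ hj))
  · intro i hi j hj hij h
    exact hdep i (hJJ hi) j (hJJ hj) hij h.of_domRestrict_comap
  · rintro _ ⟨τ, hτ, rfl⟩ j hj w hw
    exact hT' τ hτ j hj _ hw

/-! ### From pairs of subspaces to alternating forms -/

theorem exists_submodule_finrank_eq_of_le {K V : Type*} [Field K] [AddCommGroup V] [Module K V]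
    [FiniteDimensional K V] {d : ℕ} (hd : d ≤ finrank K V) :
    ∃ S : Submodule K V, finrank K S = d := by
  obtain ⟨f, hf⟩ := exists_linearIndependent_of_le_finrank hd
  exact ⟨Submodule.span K (Set.range f), by simpa using finrank_span_eq_card hf⟩

/-- The family is a basis of `B × S` with `dim S = b - dim B`; the padding meets `V × 0` only in `B
× 0`, so intersections with subspaces of `V` are unchanged. -/
theorem exists_family_prod {K V : Type*} [Field K] [AddCommGroup V] [Module K V]
    [FiniteDimensional K V] {b : ℕ} (B : Submodule K V) (hB : finrank K B ≤ b) :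
    ∃ p : Fin b → V × (Fin b → K), LinearIndependent K p ∧ (∀ k, (p k).1 ∈ B) ∧
      ∀ y ∈ B, (y, (0 : Fin b → K)) ∈ Submodule.span K (Set.range p) := by
  obtain ⟨S, hS⟩ := exists_submodule_finrank_eq_of_le (K := K) (V := Fin b → K)
    (d := b - finrank K B) (by simp)
  have hW : finrank K (B.prod S) = b := by
    have hr : LinearMap.range (B.subtype.prodMap S.subtype) = B.prod S := by
      simp [LinearMap.range_prodMap]
    rw [← hr, LinearMap.finrank_range_of_inj
      (Prod.map_injective.2 ⟨B.injective_subtype, S.injective_subtype⟩), finrank_prod, hS]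
    omega
  let v := finBasisOfFinrankEq K (B.prod S) hW
  refine ⟨fun k => (v k : V × (Fin b → K)), ?_, fun k => (v k).2.1, fun y hy => ?_⟩
  · exact v.linearIndependent.map' (B.prod S).subtype (Submodule.ker_subtype _)
  · have h1 : Submodule.span K (Set.range fun k => (v k : V × (Fin b → K))) = B.prod S := by
      have := congrArg (Submodule.map (B.prod S).subtype) v.span_eq
      rwa [Submodule.map_span, ← Set.range_comp, Submodule.map_top, Submodule.range_subtype]
        at this
    rw [h1]
    exact ⟨hy, S.zero_mem⟩

theorem corollary3p10 (N m b : ℕ)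
    (A B : Fin m → Submodule ℝ (Fin N → ℝ))
    (hA : ∀ i, A i ≠ ⊥) (hB : ∀ i, B i ≠ ⊥)
    (hb : IsGreatest (Set.range fun i => Module.finrank ℝ (B i)) b)
    (hdisj : ∀ i, Module.finrank ℝ (A i ⊓ B i : Submodule ℝ (Fin N → ℝ)) = 0)
    (hcross : ∀ i j, i ≠ j →
      0 < Module.finrank ℝ (A i ⊓ B j : Submodule ℝ (Fin N → ℝ))) :
    ∑ i, (1 : ℝ) /
      ((Module.finrank ℝ (A i) + b).choose (Module.finrank ℝ (A i)) : ℝ) ≤ 1 := by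
  choose p hpli hpB hpspan using fun i => exists_family_prod (b := b) (B i) (hb.2 ⟨i, rfl⟩)
  let V := (Fin N → ℝ) × (Fin b → ℝ)
  let A' : Fin m → Submodule ℝ V := fun i => (A i).map (LinearMap.inl ℝ _ _)
  let u : Fin m → Fin b → Dual ℝ (Dual ℝ V) := fun i k => Dual.eval ℝ V (p i k)
  have key := skew_bollobas_alternating (K := ℝ) (fun i => finrank ℝ (A i)) b
    (finrank ℝ (Dual ℝ V)) (Dual ℝ V) rfl Finset.univ (fun i => (A' i).dualAnnihilator) u ⊥
    ?_ ?_ ?_ ?_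
  · simpa [Nat.choose_symm_add] using key
  · intro j _
    have h1 := Subspace.finrank_add_finrank_dualAnnihilator_eq (A' j)
    have h2 : finrank ℝ (A' j) = finrank ℝ (A j) :=
      (Submodule.equivMapOfInjective _ LinearMap.inl_injective (A j)).finrank_eq.symm
    rw [Subspace.dual_finrank_eq]
    omega
  · intro j _
    rw [Fintype.linearIndependent_iff]
    intro g hg
    refine Fintype.linearIndependent_iff.1 (hpli j) g ?_
    -- A vector killed by the whole annihilator of `A' j` lies in `A' j`.
    have hq : ∑ k, g k • p j k ∈ A' j := by
      rw [← Subspace.forall_mem_dualAnnihilator_apply_eq_zero_iff]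
      intro φ hφ
      simpa [u] using LinearMap.congr_fun hg ⟨φ, hφ⟩
    obtain ⟨y, hyA, hy⟩ := hq
    have hyB : y ∈ B j := by
      have h1 : y = (∑ k, g k • p j k).1 := by rw [← hy]; rfl
      rw [h1, Prod.fst_sum]
      exact Submodule.sum_mem _ fun k _ => (B j).smul_mem _ (hpB j k)
    have h0 : y ∈ A j ⊓ B j := ⟨hyA, hyB⟩
    rw [Submodule.finrank_eq_zero.1 (hdisj j), Submodule.mem_bot] at h0
    rw [← hy, h0, map_zero]
  · intro i _ j _ hij h
    have hne : A j ⊓ B i ≠ ⊥ := fun h0 => by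
      have := hcross j i hij.symm
      rw [h0] at this
      simp at this
    obtain ⟨y, hy, hy0⟩ := Submodule.exists_mem_ne_zero_of_ne_bot hne
    obtain ⟨c, hc⟩ := (Submodule.mem_span_range_iff_exists_fun ℝ).1 (hpspan i y hy.2)
    -- Evaluation at `(y, 0)` vanishes on the annihilator of `A' j`, so assumed independence kills
    -- its coefficients.
    have hc0 : ∀ k, c k = 0 := by
      refine Fintype.linearIndependent_iff.1 h c (LinearMap.ext fun φ => ?_)
      have h1 : (φ : Dual ℝ V) (∑ k, c k • p i k) = 0 := by
        rw [hc]
        exact (Submodule.mem_dualAnnihilator _).1 φ.2 _ ⟨y, hy.1, rfl⟩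
      simpa [u] using h1
    exact hy0 (by simpa [hc0] using (congrArg Prod.fst hc).symm)
  · intro τ hτ j _ w _
    rw [(Submodule.mem_bot ℝ).1 hτ]
    rfl
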